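/- Let $\mu$ be a probability measure on $\mathbb{C}$ with a continuous and compactly supported density with respect to Lebesgue measure. Let $z_1, z_2, \dots$ be independent random variables with law $\mu$, and let $p_n(z) = \prod_{k=1}^n (z - z_k)$. Put $$A = \Big\{ z \in \mathbb{C} : \int_{\mathbb{C}} \log|x-z|\, d\mu(x) > \int_{\mathbb{C}} \log|x|\, d\mu(x) \Big\}, \qquad B = \Big\{ z \in \mathbb{C} : \int_{\mathbb{C}} \log|x-z|\, d\mu(x) = \int_{\mathbb{C}} \log|x|\, d\mu(x) \Big\}.$$ Then there is a probability measure $\nu$ on $\mathbb{C}$, depending only on $\mu$, such that $\nu = \mu$ on $A$ (that is, $\nu(E) = \mu(E)$ for all Borel sets $E \subseteq A$), $\nu(B) = 1 - \mu(A)$, and the following holds: if $w_1, \dots, w_n$ denote the solutions of $p_n(w) = p_n(0)$, counted with multiplicity, then almost surely the empirical distribution $\frac1n \sum_{k=1}^n \delta_{w_k}$ converges weakly to $\nu$ as $n \to \infty$. -/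

import Mathlib

open MeasureTheory ProbabilityTheory Filter Topology Polynomial
open scoped NNReal ENNReal

/-- The logarithmic potential `z ↦ ∫ log |x - z| dμ(x)`. For a measure with a bounded, compactly
supported density the integrand is integrable for every `z`, so this is a genuine integral. -/
noncomputable def logPotential (μ : Measure ℂ) (z : ℂ) : ℝ :=
  ∫ x, Real.log ‖x - z‖ ∂μ

/-- The set `A` on which the logarithmic potential exceeds its value at the origin. -/
def potentialAbove (μ : Measure ℂ) : Set ℂ :=
  {z | logPotential μ z > logPotential μ 0}

/-- The level set `B` on which the logarithmic potential equals its value at the origin. -/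
def potentialLevel (μ : Measure ℂ) : Set ℂ :=
  {z | logPotential μ z = logPotential μ 0}

/-- The monic polynomial `p_n(X) = ∏_{k < n} (X - z_k)` of degree `n`. -/
noncomputable def rootPoly (z : ℕ → ℂ) (n : ℕ) : ℂ[X] :=
  ∏ k ∈ Finset.range n, (X - C (z k))

/-- The multiset of the solutions `w` of `p_n(w) = p_n(0)`, counted with multiplicity. -/
noncomputable def solutions (z : ℕ → ℂ) (n : ℕ) : Multiset ℂ :=
  (rootPoly z n - C ((rootPoly z n).eval 0)).roots

/-- The empirical distribution `(1/n) ∑ δ_w` of the `n` solutions `w` of `p_n(w) = p_n(0)`.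
For `n ≥ 1` this has total mass one. -/
noncomputable def solutionMeasure (z : ℕ → ℂ) (n : ℕ) : FiniteMeasure ℂ :=
  (n : ℝ≥0)⁻¹ • ((solutions z n).map fun w => (diracProba w).toFiniteMeasure).sum

/-!
Write `U = logPotential μ` and `V = max U (U 0)`. The measure `ν` is the one whose logarithmic
potential is `V`, that is, `ν = Δ V / 2π` as a distribution; it agrees with
`Δ U / 2π = μ` on the open set `{U > U 0}`, and vanishes on the open set `{U < U 0}`, where `V` is
constant, so that the remaining mass `1 - μ {U > U 0}` sits on the level set.

*Convergence of potentials.* The potential of the empirical distribution of the solutions is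
`u_n(z) = (1/n) log |p_n(z) - p_n(0)|` (`solutionPotential`). By the strong law of large numbers,
`(1/n) log |p_n(z)|` tends to `U z` almost surely. This gives `u_n(z) → V z` unless `p_n(z)` and
`p_n(0)` may cancel. Cancellation is excluded for every `z ≠ 0`, in particular on the level set,
however large that is, as follows. From
`p_{n+1}(z) - p_{n+1}(0) = z p_n(z) - z_n (p_n(z) - p_n(0))`, where `z_n` is the new root, which is
independent of `p_n` and has a bounded density, an exponentially small value of the left side has
exponentially small probability unless `p_n(z) - p_n(0)` is itself much smaller than `p_n(0)`, and
in that case the left side is close to `z p_n(z) ≈ z p_n(0)`, which is not small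
(`measure_affine_lt_le`, `ae_eventually_exp_le_norm_sub`). By Borel-Cantelli and Fubini, almost
surely `u_n → V` almost everywhere in the plane (`ae_ae_tendsto_solutionPotential`).

*From potentials to measures.* Let `L g (w) = ∫ log |z - w| g(z) dz`. All solutions lie in a fixed
disc, so the `u_n` are uniformly integrable on compact sets and
`∫ L g dν_n = ∫ u_n g → ∫ V g` for continuous compactly supported `g`
(`tendsto_integral_log_potential`). Every test function `φ` is a uniform limit of functions `L g`
with `g` of total mass zero and supported near `φ` (`exists_log_potential_approx`): for `g` the
difference of the averages of `φ` over circles of radii `2r` and `r`, Jensen's formula shows that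
`L g` is the convolution of `φ` with a small nonnegative bump. Hence the limits of `∫ φ dν_n` are
determined by `V`. They are realised by a cluster point `ν` of the empirical distributions for one
typical realisation of the roots, and the same approximation identifies `ν` on `{U > U 0}` and on
`{U < U 0}`.
-/

/-! ### Local integrability of the logarithmic kernel -/

theorem locallyIntegrable_log_norm : LocallyIntegrable (fun z : ℂ => Real.log ‖z‖) := by
  refine fun x => ⟨Metric.ball 0 (‖x‖ + 1),
    Metric.isOpen_ball.mem_nhds (by simp), ?_⟩
  rw [integrableOn_fun_norm_addHaar (volume : Measure ℂ) (f := Real.log)]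
  simp only [Complex.finrank_real_complex, Nat.add_one_sub_one, pow_one, smul_eq_mul]
  exact (Real.continuous_mul_log.integrableOn_Icc (a := 0) (b := ‖x‖ + 1)).mono_set
    Set.Ioo_subset_Icc_self

theorem locallyIntegrable_log_norm_sub (w : ℂ) :
    LocallyIntegrable (fun z : ℂ => Real.log ‖z - w‖) := by
  rw [locallyIntegrable_iff]
  intro K hK
  have h := (locallyIntegrable_iff.1 locallyIntegrable_log_norm) ((fun z => z - w) '' K)
    (hK.image (by fun_prop))
  exact ((measurePreserving_sub_right volume w).integrableOn_image
    (Homeomorph.subRight w).measurableEmbedding).1 h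

theorem integrable_log_norm_sub_mul {g : ℂ → ℝ} (hg : Continuous g) (hgc : HasCompactSupport g)
    (w : ℂ) : Integrable (fun z => Real.log ‖z - w‖ * g z) := by
  simpa [mul_comm] using
    (locallyIntegrable_log_norm_sub w).integrable_smul_left_of_hasCompactSupport hg hgc

/-! ### Averages over circles -/

theorem continuous_circleAverage {φ : ℂ → ℝ} (hφ : Continuous φ) (r : ℝ) :
    Continuous (fun z => Real.circleAverage φ z r) := by
  unfold Real.circleAverage
  refine Continuous.smul (continuous_const (y := (2 * Real.pi)⁻¹)) ?_
  refine intervalIntegral.continuous_parametric_intervalIntegral_of_continuous' ?_ _ _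
  simp only [Function.uncurry_def, circleMap]
  fun_prop

theorem support_circleAverage_subset (φ : ℂ → ℝ) {r : ℝ} (hr : 0 ≤ r) :
    Function.support (fun z => Real.circleAverage φ z r) ⊆
      Metric.cthickening r (tsupport φ) := by
  intro z hz
  by_contra hcon
  refine hz ?_
  have : ∀ θ, φ (circleMap z r θ) = 0 := by
    intro θ
    by_contra hθ
    refine hcon (Metric.mem_cthickening_of_dist_le z (circleMap z r θ) _ _
      (subset_tsupport _ hθ) ?_)
    rw [dist_comm, dist_eq_norm]
    simp [circleMap, abs_of_nonneg hr]
  simp [Real.circleAverage, this]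

theorem hasCompactSupport_circleAverage {φ : ℂ → ℝ} (hφc : HasCompactSupport φ)
    {r : ℝ} (hr : 0 ≤ r) : HasCompactSupport (fun z => Real.circleAverage φ z r) :=
  HasCompactSupport.of_support_subset_isCompact (hφc.isCompact.cthickening)
    (support_circleAverage_subset φ hr)

/-- Averaging over circles is self-adjoint: it can be moved from a test function to a locally
integrable kernel. -/
theorem integral_mul_circleAverage {k φ : ℂ → ℝ} (hk : LocallyIntegrable k) (hφ : Continuous φ)
    (hφc : HasCompactSupport φ) {r : ℝ} (hr : 0 ≤ r) :
    ∫ z, k z * Real.circleAverage φ z r = ∫ y, φ y * Real.circleAverage k y r := by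
  set m : Measure ℝ := volume.restrict (Set.Ioc 0 (2 * Real.pi)) with hm
  set c : ℝ → ℂ := fun θ => circleMap 0 r θ with hc
  have hcc : Continuous c := continuous_circleMap 0 r
  obtain ⟨M, hM⟩ := hφc.exists_bound_of_continuous hφ
  set K := Metric.cthickening r (tsupport φ) with hKdef
  have hK : IsCompact K := hφc.isCompact.cthickening
  have hkK : IntegrableOn k K := (locallyIntegrable_iff.1 hk) K hK
  have hF : Integrable (fun p : ℝ × ℂ => k p.2 * φ (p.2 + c p.1)) (m.prod volume) := by
    have h1 : Integrable (fun p : ℝ × ℂ => M * K.indicator k p.2) (m.prod volume) :=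
      ((hkK.integrable_indicator hK.measurableSet).comp_snd m).const_mul M
    refine h1.mono ?_ (Eventually.of_forall fun p => ?_)
    · exact (hk.aestronglyMeasurable.comp_snd).mul (by fun_prop)
    · by_cases hp : p.2 ∈ K
      · simp only [norm_mul, Set.indicator_of_mem hp]
        rw [mul_comm]
        gcongr
        exact (hM _).trans (le_abs_self M)
      · have : φ (p.2 + c p.1) = 0 := by
          by_contra hne
          refine hp (Metric.mem_cthickening_of_dist_le _ _ _ _ (subset_tsupport _ hne) ?_)
          rw [dist_eq_norm]
          simp [hc, circleMap, abs_of_nonneg hr]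
        simp [this, Set.indicator_of_notMem hp]
  have hshear : MeasurePreserving (fun p : ℝ × ℂ => (p.1, p.2 - c p.1))
      (m.prod volume) (m.prod volume) := by
    refine (MeasurePreserving.id m).skew_product (g := fun θ y => y - c θ) ?_ ?_
    · simp only [Function.uncurry_def]; fun_prop
    · exact Eventually.of_forall fun θ => (measurePreserving_sub_right volume (c θ)).map_eq
  have hG : Integrable (fun p : ℝ × ℂ => k (p.2 - c p.1) * φ p.2) (m.prod volume) := by
    have := hshear.integrable_comp_of_integrable hF
    simpa [Function.comp_def] using this
  have h2pi : (0:ℝ) ≤ 2 * Real.pi := by positivity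
  have hsymm : ∀ y, Real.circleAverage k y r = (2 * Real.pi)⁻¹ * ∫ θ, k (y - c θ) ∂m := by
    intro y
    -- The reflection `y - r e^{iθ}` runs through the same circle, shifted by half a period.
    have h1 : ∀ θ, y - c θ = circleMap y r (θ + Real.pi) := by
      intro θ
      simp [hc, circleMap, add_mul, Complex.exp_add]
      ring
    simp_rw [h1]
    rw [hm, ← intervalIntegral.integral_of_le h2pi, Real.circleAverage, smul_eq_mul]
    congr 1
    have hper : Function.Periodic (fun θ => k (circleMap y r θ)) (2 * Real.pi) :=
      fun θ => by simp only [periodic_circleMap y r θ]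
    rw [intervalIntegral.integral_comp_add_right (fun θ => k (circleMap y r θ))]
    have := hper.intervalIntegral_add_eq 0 (0 + Real.pi)
    rw [zero_add] at this
    rw [this]
    congr 1
    ring
  have havg : ∀ z, Real.circleAverage φ z r = (2 * Real.pi)⁻¹ * ∫ θ, φ (z + c θ) ∂m := by
    intro z
    rw [hm, ← intervalIntegral.integral_of_le h2pi, Real.circleAverage, smul_eq_mul]
    simp [hc, circleMap]
  calc ∫ z, k z * Real.circleAverage φ z r
      = (2 * Real.pi)⁻¹ * ∫ z, ∫ θ, k z * φ (z + c θ) ∂m := by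
        rw [← integral_const_mul]
        congr 1; ext z
        rw [havg, integral_const_mul]; ring
    _ = (2 * Real.pi)⁻¹ * ∫ θ, (∫ z, k z * φ (z + c θ)) ∂m := by
        congr 1
        exact (integral_integral_swap (f := fun θ z => k z * φ (z + c θ)) hF).symm
    _ = (2 * Real.pi)⁻¹ * ∫ θ, (∫ y, k (y - c θ) * φ y) ∂m := by
        congr 2; ext θ
        rw [← integral_sub_right_eq_self (fun z => k z * φ (z + c θ)) (c θ)]
        simp
    _ = (2 * Real.pi)⁻¹ * ∫ y, ∫ θ, k (y - c θ) * φ y ∂m := by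
        congr 1
        exact integral_integral_swap (f := fun θ y => k (y - c θ) * φ y) hG
    _ = ∫ y, φ y * Real.circleAverage k y r := by
        rw [← integral_const_mul]
        congr 1; ext y
        rw [hsymm, integral_mul_const]; ring

theorem circleAverage_log_norm_sub (y w : ℂ) {r : ℝ} (hr : 0 < r) :
    Real.circleAverage (fun z => Real.log ‖z - w‖) y r = Real.log (max r ‖y - w‖) := by
  rw [circleAverage_log_norm_sub_const_eq_log_radius_add_posLog hr.ne']
  rcases le_total ‖y - w‖ r with h | h
  · rw [max_eq_left h, Real.posLog_eq_zero_iff _ |>.2, add_zero]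
    rw [abs_of_nonneg (by positivity), inv_mul_le_one₀ hr]
    exact h
  · have hpos : 0 < ‖y - w‖ := hr.trans_le h
    rw [max_eq_right h, Real.posLog_eq_log, Real.log_mul (by positivity) (by positivity),
      Real.log_inv]
    · ring
    · rw [abs_of_nonneg (by positivity), le_inv_mul_iff₀ hr, mul_one]
      exact h

/-! ### Test functions as logarithmic potentials -/

/-- The radial bump `y ↦ log max(2r, |y|) - log max(r, |y|)`: the logarithmic potential of the
uniform measure on the circle of radius `2r` minus that of the circle of radius `r`. -/
noncomputable def logBump (r : ℝ) (y : ℂ) : ℝ :=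
  Real.log (max (2 * r) ‖y‖) - Real.log (max r ‖y‖)

theorem continuous_logBump {r : ℝ} (hr : 0 < r) : Continuous (logBump r) := by
  unfold logBump
  refine Continuous.sub (Continuous.log (by fun_prop) fun y => ?_)
    (Continuous.log (by fun_prop) fun y => ?_)
  · exact (lt_max_of_lt_left (by positivity)).ne'
  · exact (lt_max_of_lt_left hr).ne'

theorem logBump_nonneg {r : ℝ} (hr : 0 < r) (y : ℂ) : 0 ≤ logBump r y := by
  unfold logBump
  rw [sub_nonneg]
  apply Real.log_le_log (lt_max_of_lt_left hr)
  exact max_le_max_right _ (by linarith)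

theorem logBump_eq_zero {r : ℝ} (hr : 0 < r) {y : ℂ} (hy : 2 * r ≤ ‖y‖) : logBump r y = 0 := by
  unfold logBump
  rw [max_eq_right hy, max_eq_right (by linarith), sub_self]

theorem hasCompactSupport_logBump {r : ℝ} (hr : 0 < r) : HasCompactSupport (logBump r) := by
  refine HasCompactSupport.of_support_subset_isCompact (isCompact_closedBall (0 : ℂ) (2 * r)) ?_
  intro y hy
  by_contra h
  rw [mem_closedBall_zero_iff, not_le] at h
  exact hy (logBump_eq_zero hr h.le)

theorem integrable_logBump {r : ℝ} (hr : 0 < r) : Integrable (logBump r) :=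
  (continuous_logBump hr).integrable_of_hasCompactSupport (hasCompactSupport_logBump hr)

theorem integral_logBump_pos {r : ℝ} (hr : 0 < r) : 0 < ∫ y, logBump r y := by
  refine (continuous_logBump hr).integral_pos_of_hasCompactSupport_nonneg_nonzero
    (hasCompactSupport_logBump hr) (logBump_nonneg hr) (x := 0) ?_
  have : logBump r 0 = Real.log 2 := by
    unfold logBump
    rw [norm_zero, max_eq_left (by positivity), max_eq_left hr.le,
      Real.log_mul (by norm_num) hr.ne']
    ring
  rw [this]
  exact (Real.log_pos (by norm_num)).ne'

/-- Every test function is uniformly approximated by logarithmic potentials of continuous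
densities of total mass zero supported near its support. The density is, up to a constant, the
difference of the averages of `φ` over circles of radii `2r` and `r`, whose potential is the
convolution of `φ` with `logBump r`. -/
theorem exists_log_potential_approx {φ : ℂ → ℝ} (hφ : Continuous φ) (hφc : HasCompactSupport φ)
    {ε δ : ℝ} (hε : 0 < ε) (hδ : 0 < δ) :
    ∃ g : ℂ → ℝ, Continuous g ∧ HasCompactSupport g ∧
      Function.support g ⊆ Metric.cthickening δ (tsupport φ) ∧ ∫ z, g z = 0 ∧
      ∀ w, |(∫ z, Real.log ‖z - w‖ * g z) - φ w| ≤ ε := by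
  obtain ⟨η, hη, hηφ⟩ := Metric.uniformContinuous_iff.1 (hφc.uniformContinuous_of_continuous
    hφ) ε hε
  obtain ⟨r, hr, hrη, hrδ⟩ : ∃ r : ℝ, 0 < r ∧ 2 * r ≤ η ∧ 2 * r ≤ δ :=
    ⟨min η δ / 2, by positivity, by linarith [min_le_left η δ], by linarith [min_le_right η δ]⟩
  set c := ∫ y, logBump r y with hc
  have hcpos : 0 < c := integral_logBump_pos hr
  have hr2 : 0 < 2 * r := by positivity
  have hint : ∀ s, 0 ≤ s → Integrable (fun z => Real.circleAverage φ z s) := fun s hs =>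
    (continuous_circleAverage hφ s).integrable_of_hasCompactSupport
      (hasCompactSupport_circleAverage hφc hs)
  refine ⟨fun z => c⁻¹ * (Real.circleAverage φ z (2 * r) - Real.circleAverage φ z r),
    ?_, ?_, ?_, ?_, ?_⟩
  · exact continuous_const.mul
      ((continuous_circleAverage hφ _).sub (continuous_circleAverage hφ _))
  · exact ((hasCompactSupport_circleAverage hφc hr2.le).sub
      (hasCompactSupport_circleAverage hφc hr.le)).mul_left
  · intro z hz
    by_contra hcon
    have h0 : ∀ s, 0 < s → s ≤ δ → Real.circleAverage φ z s = 0 := fun s hs hsδ => by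
      by_contra hne
      exact hcon (Metric.cthickening_mono hsδ _ (support_circleAverage_subset φ hs.le hne))
    exact hz (by simp [h0 (2 * r) hr2 hrδ, h0 r hr (by linarith)])
  · have h1 : ∀ s, 0 ≤ s → ∫ z, Real.circleAverage φ z s = ∫ z, φ z := fun s hs => by
      simpa [Real.circleAverage_const] using integral_mul_circleAverage (k := fun _ => 1)
        (continuous_const.locallyIntegrable) hφ hφc hs
    rw [integral_const_mul, integral_sub (hint _ hr2.le) (hint _ hr.le), h1 _ hr2.le, h1 _ hr.le]
    simp
  · intro w
    have hi : ∀ s, 0 < s → Integrable (fun z => Real.log ‖z - w‖ * Real.circleAverage φ z s) :=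
      fun s hs => integrable_log_norm_sub_mul (continuous_circleAverage hφ s)
        (hasCompactSupport_circleAverage hφc hs.le) w
    have hi' : ∀ s, 0 < s → Integrable (fun y => φ y * Real.log (max s ‖y - w‖)) := fun s hs => by
      refine Continuous.integrable_of_hasCompactSupport ?_ hφc.mul_right
      exact hφ.mul (Continuous.log (by fun_prop) fun y => (lt_max_of_lt_left hs).ne')
    have hpot : ∀ s, 0 < s → ∫ z, Real.log ‖z - w‖ * Real.circleAverage φ z s =
        ∫ y, φ y * Real.log (max s ‖y - w‖) := fun s hs => by
      rw [integral_mul_circleAverage (locallyIntegrable_log_norm_sub w) hφ hφc hs.le]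
      simp_rw [circleAverage_log_norm_sub _ w hs]
    have hconv : ∫ z, Real.log ‖z - w‖ * (c⁻¹ * (Real.circleAverage φ z (2 * r) -
        Real.circleAverage φ z r)) = c⁻¹ * ∫ y, φ y * logBump r (y - w) := by
      have e1 : ∀ z, Real.log ‖z - w‖ * (c⁻¹ * (Real.circleAverage φ z (2 * r) -
          Real.circleAverage φ z r)) = c⁻¹ * (Real.log ‖z - w‖ * Real.circleAverage φ z (2 * r) -
          Real.log ‖z - w‖ * Real.circleAverage φ z r) := fun z => by ring
      simp_rw [e1]
      rw [integral_const_mul, integral_sub (hi _ hr2) (hi _ hr), hpot _ hr2, hpot _ hr,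
        ← integral_sub (hi' _ hr2) (hi' _ hr)]
      simp_rw [← mul_sub]
      rfl
    have hb : Integrable (fun y => logBump r (y - w)) := (integrable_logBump hr).comp_sub_right w
    have hbc : ∫ y, logBump r (y - w) = c := integral_sub_right_eq_self (logBump r) w
    have hφb : Integrable (fun y => φ y * logBump r (y - w)) :=
      (hφ.mul ((continuous_logBump hr).comp (by fun_prop))).integrable_of_hasCompactSupport
        hφc.mul_right
    have hdiff : (c⁻¹ * ∫ y, φ y * logBump r (y - w)) - φ w =
        c⁻¹ * ∫ y, (φ y - φ w) * logBump r (y - w) := by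
      simp_rw [sub_mul]
      rw [integral_sub hφb (hb.const_mul _), integral_const_mul, hbc]
      field_simp
    rw [hconv, hdiff, abs_mul, abs_of_pos (inv_pos.2 hcpos), inv_mul_le_iff₀ hcpos]
    calc |∫ y, (φ y - φ w) * logBump r (y - w)|
        ≤ ∫ y, ε * logBump r (y - w) := by
          refine norm_integral_le_of_norm_le (f := fun y => (φ y - φ w) * logBump r (y - w))
            (hb.const_mul ε) (Eventually.of_forall fun y => ?_)
          rw [norm_mul, Real.norm_of_nonneg (logBump_nonneg hr _)]
          by_cases hy : ‖y - w‖ < 2 * r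
          · refine mul_le_mul_of_nonneg_right ?_ (logBump_nonneg hr _)
            rw [← dist_eq_norm]
            exact (hηφ (by rw [dist_eq_norm]; linarith)).le
          · rw [logBump_eq_zero hr (not_lt.1 hy)]; simp
      _ = c * ε := by rw [integral_const_mul, hbc, mul_comm]

/-! ### The solutions of `p_n(w) = p_n(0)` -/

theorem eval_rootPoly (z : ℕ → ℂ) (n : ℕ) (w : ℂ) :
    (rootPoly z n).eval w = ∏ k ∈ Finset.range n, (w - z k) := by
  simp [rootPoly, eval_prod]

theorem monic_rootPoly_sub_C (z : ℕ → ℂ) {n : ℕ} (hn : 0 < n) (c : ℂ) :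
    (rootPoly z n - C c).Monic ∧ (rootPoly z n - C c).natDegree = n := by
  have hm : (rootPoly z n).Monic := monic_prod_X_sub_C _ _
  have hd : (rootPoly z n).natDegree = n := by
    simp [rootPoly]
  refine ⟨hm.sub_of_left ?_, by rw [natDegree_sub_C, hd]⟩
  refine degree_C_le.trans_lt ?_
  rw [degree_eq_natDegree hm.ne_zero, hd]
  exact_mod_cast hn

theorem solutions_zero (z : ℕ → ℂ) : solutions z 0 = 0 := by
  simp [solutions, rootPoly]

theorem card_solutions (z : ℕ → ℂ) (n : ℕ) : Multiset.card (solutions z n) = n := by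
  rcases Nat.eq_zero_or_pos n with rfl | hn
  · simp [solutions_zero]
  · rw [solutions, ← (IsAlgClosed.splits _).natDegree_eq_card_roots,
      (monic_rootPoly_sub_C z hn _).2]

theorem mem_solutions {z : ℕ → ℂ} {n : ℕ} (hn : 0 < n) {w : ℂ} :
    w ∈ solutions z n ↔ (rootPoly z n).eval w = (rootPoly z n).eval 0 := by
  rw [solutions, mem_roots (monic_rootPoly_sub_C z hn _).1.ne_zero]
  simp [sub_eq_zero]

theorem norm_le_of_mem_solutions {z : ℕ → ℂ} {R : ℝ} (hz : ∀ k, ‖z k‖ ≤ R) {n : ℕ} {w : ℂ}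
    (hw : w ∈ solutions z n) : ‖w‖ ≤ 2 * R := by
  rcases Nat.eq_zero_or_pos n with rfl | hn
  · simp [solutions_zero] at hw
  by_contra! hlt
  have hR : 0 ≤ R := (norm_nonneg _).trans (hz 0)
  rw [mem_solutions hn, eval_rootPoly, eval_rootPoly] at hw
  have h := congrArg norm hw
  rw [norm_prod, norm_prod] at h
  refine absurd h (ne_of_gt ?_)
  calc ∏ k ∈ Finset.range n, ‖0 - z k‖ ≤ ∏ _k ∈ Finset.range n, R :=
        Finset.prod_le_prod (fun _ _ => norm_nonneg _) fun k _ => by simpa using hz k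
    _ = R ^ n := by simp
    _ < (‖w‖ - R) ^ n := pow_lt_pow_left₀ (by linarith) hR hn.ne'
    _ = ∏ _k ∈ Finset.range n, (‖w‖ - R) := by simp
    _ ≤ ∏ k ∈ Finset.range n, ‖w - z k‖ :=
        Finset.prod_le_prod (fun _ _ => by linarith) fun k _ => by
          linarith [norm_sub_norm_le w (z k), hz k]

theorem norm_eval_sub_eq_prod (z : ℕ → ℂ) {n : ℕ} (hn : 0 < n) (w : ℂ) :
    ‖(rootPoly z n).eval w - (rootPoly z n).eval 0‖ =
      ((solutions z n).map fun v => ‖w - v‖).prod := by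
  have h := (IsAlgClosed.splits (rootPoly z n - C ((rootPoly z n).eval 0))).eval_eq_prod_roots_of_monic
    (monic_rootPoly_sub_C z hn _).1 w
  rw [eval_sub, eval_C] at h
  rw [h, solutions]
  have := map_multiset_prod (normHom : ℂ →*₀ ℝ)
    (Multiset.map (fun a => w - a) (rootPoly z n - C ((rootPoly z n).eval 0)).roots)
  simpa [Multiset.map_map, Function.comp_def] using this

/-- The normalised potential `(1/n) log |p_n(w) - p_n(0)|`. -/
noncomputable def solutionPotential (z : ℕ → ℂ) (n : ℕ) (w : ℂ) : ℝ :=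
  (n : ℝ)⁻¹ * Real.log ‖(rootPoly z n).eval w - (rootPoly z n).eval 0‖

theorem solutionPotential_eq_sum {z : ℕ → ℂ} {n : ℕ} {w : ℂ} (hw : w ∉ solutions z n) :
    solutionPotential z n w =
      (n : ℝ)⁻¹ * ((solutions z n).map fun v => Real.log ‖w - v‖).sum := by
  rcases Nat.eq_zero_or_pos n with rfl | hn
  · simp [solutionPotential]
  · rw [solutionPotential, norm_eval_sub_eq_prod z hn, Real.log_multiset_prod, Multiset.map_map]
    · rfl
    · intro x hx
      obtain ⟨v, hv, rfl⟩ := Multiset.mem_map.1 hx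
      rw [norm_ne_zero_iff, sub_ne_zero]
      exact fun h => hw (h ▸ hv)

/-! ### The empirical distribution of the solutions -/

theorem integral_sum_diracProba (m : Multiset ℂ) (φ : ℂ → ℝ) :
    Integrable φ ((m.map fun w => (diracProba w).toFiniteMeasure).sum : FiniteMeasure ℂ) ∧
    ∫ x, φ x ∂((m.map fun w => (diracProba w).toFiniteMeasure).sum : FiniteMeasure ℂ) =
      (m.map φ).sum := by
  induction m using Multiset.induction_on with
  | empty => simp
  | cons a m ih =>
    have ha : ((diracProba a).toFiniteMeasure : Measure ℂ) = Measure.dirac a := rfl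
    have hi : Integrable φ (Measure.dirac a) := integrable_dirac (by simp)
    rw [Multiset.map_cons, Multiset.sum_cons, FiniteMeasure.toMeasure_add, ha]
    refine ⟨hi.add_measure ih.1, ?_⟩
    rw [integral_add_measure hi ih.1, ih.2, integral_dirac]
    simp

theorem integral_solutionMeasure (z : ℕ → ℂ) (n : ℕ) (φ : ℂ → ℝ) :
    ∫ x, φ x ∂(solutionMeasure z n : Measure ℂ) = (n : ℝ)⁻¹ * ((solutions z n).map φ).sum := by
  rw [solutionMeasure, FiniteMeasure.toMeasure_smul, integral_smul_nnreal_measure,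
    (integral_sum_diracProba _ φ).2]
  simp [NNReal.smul_def]

theorem integrable_solutionMeasure (z : ℕ → ℂ) (n : ℕ) (φ : ℂ → ℝ) :
    Integrable φ (solutionMeasure z n : Measure ℂ) := by
  rw [solutionMeasure, FiniteMeasure.toMeasure_smul]
  exact (integral_sum_diracProba _ φ).1.smul_measure_nnreal

theorem mass_solutionMeasure (z : ℕ → ℂ) {n : ℕ} (hn : 0 < n) : (solutionMeasure z n).mass = 1 := by
  have h := integral_solutionMeasure z n fun _ => 1
  rw [Multiset.map_const', Multiset.sum_replicate, card_solutions] at h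
  have hn' : (n : ℝ) ≠ 0 := by exact_mod_cast hn.ne'
  simp [hn', Measure.real] at h
  rw [← NNReal.coe_inj, NNReal.coe_one, ← h]
  rfl

theorem solutionMeasure_compl_closedBall {z : ℕ → ℂ} {R : ℝ} (hz : ∀ k, ‖z k‖ ≤ R) (n : ℕ) :
    solutionMeasure z n (Metric.closedBall 0 (2 * R))ᶜ = 0 := by
  have hms : MeasurableSet (Metric.closedBall (0 : ℂ) (2 * R))ᶜ :=
    Metric.isClosed_closedBall.measurableSet.compl
  have h := integral_solutionMeasure z n
    ((Metric.closedBall (0 : ℂ) (2 * R))ᶜ.indicator fun _ => (1 : ℝ))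
  rw [integral_indicator hms, setIntegral_const, smul_eq_mul, mul_one,
    Multiset.map_congr rfl (g := fun _ => (0 : ℝ))] at h
  · simp only [Multiset.map_const', Multiset.sum_replicate, smul_zero, mul_zero] at h
    rw [← NNReal.coe_inj, NNReal.coe_zero, ← h]
    rfl
  · intro w hw
    simpa using norm_le_of_mem_solutions hz hw

/-! ### Convergence of potentials implies convergence of their integrals -/

/-- Uniform integrability of the translated kernels `log |· - w|` on a compact set, for `w` in a
bounded set. -/
theorem exists_eLpNorm_indicator_log_norm_sub_le {K : Set ℂ} (hK : IsCompact K) (ρ : ℝ) {ε : ℝ}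
    (hε : 0 < ε) : ∃ δ : ℝ, 0 < δ ∧ ∀ s, MeasurableSet s →
      volume.restrict K s ≤ ENNReal.ofReal δ → ∀ w : ℂ, ‖w‖ ≤ ρ →
        eLpNorm (s.indicator fun z => Real.log ‖z - w‖) 1 (volume.restrict K) ≤
          ENNReal.ofReal ε := by
  obtain ⟨r, hr⟩ := hK.isBounded.subset_closedBall 0
  set B := Metric.closedBall (0 : ℂ) (r + ρ)
  have hB : MeasurableSet B := Metric.isClosed_closedBall.measurableSet
  have hf : MemLp (fun z : ℂ => Real.log ‖z‖) 1 (volume.restrict B) :=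
    memLp_one_iff_integrable.2
      ((locallyIntegrable_iff.1 locallyIntegrable_log_norm) B (isCompact_closedBall _ _))
  obtain ⟨δ, hδ, h⟩ := hf.eLpNorm_indicator_le le_rfl ENNReal.one_ne_top hε
  refine ⟨δ, hδ, fun s hs hsδ w hw => ?_⟩
  set T := (fun z => z + w) ⁻¹' (s ∩ K) with hT
  have hsK : MeasurableSet (s ∩ K) := hs.inter hK.measurableSet
  have hTm : MeasurableSet T := hsK.preimage (by fun_prop)
  have hTB : T ⊆ B := fun z hz => by
    have h1 : ‖z + w‖ ≤ r := by simpa using hr hz.2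
    rw [mem_closedBall_zero_iff]
    have := norm_sub_le (z + w) w
    rw [add_sub_cancel_right] at this
    linarith
  have hTδ : volume.restrict B T ≤ ENNReal.ofReal δ := by
    rw [Measure.restrict_apply hTm, Set.inter_eq_self_of_subset_left hTB, hT,
      (measurePreserving_add_right volume w).measure_preimage hsK.nullMeasurableSet,
      ← Measure.restrict_apply hs]
    exact hsδ
  refine le_trans (le_of_eq ?_) (h T hTm hTδ)
  rw [eLpNorm_indicator_eq_eLpNorm_restrict hs, Measure.restrict_restrict hs,
    eLpNorm_indicator_eq_eLpNorm_restrict hTm, Measure.restrict_restrict hTm,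
    Set.inter_eq_self_of_subset_left hTB, ← eLpNorm_indicator_eq_eLpNorm_restrict hsK,
    ← eLpNorm_indicator_eq_eLpNorm_restrict hTm,
    ← eLpNorm_comp_measurePreserving (g := T.indicator fun z => Real.log ‖z‖)
      (f := fun z => z - w) (ν := volume) _ (measurePreserving_sub_right volume w)]
  · congr 1
    ext z
    have hiff : z - w ∈ T ↔ z ∈ s ∩ K := by rw [hT, Set.mem_preimage, sub_add_cancel]
    by_cases hz : z ∈ s ∩ K
    · rw [Function.comp_apply, Set.indicator_of_mem hz, Set.indicator_of_mem (hiff.2 hz)]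
    · rw [Function.comp_apply, Set.indicator_of_notMem hz, Set.indicator_of_notMem (by rwa [hiff])]
  · exact locallyIntegrable_log_norm.aestronglyMeasurable.indicator hTm

theorem measurable_multiset_sum_log_norm_sub (m : Multiset ℂ) :
    Measurable fun z => (m.map fun w => Real.log ‖z - w‖).sum := by
  induction m using Multiset.induction_on with
  | empty => simp
  | cons a m ih =>
    simp only [Multiset.map_cons, Multiset.sum_cons]
    exact Measurable.add (by fun_prop) ih

theorem eLpNorm_indicator_multiset_sum_le {μ : Measure ℂ} {s : Set ℂ} (hs : MeasurableSet s)
    (m : Multiset ℂ) {ε : ℝ≥0∞} (h : ∀ w ∈ m,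
      eLpNorm (s.indicator fun z => Real.log ‖z - w‖) 1 μ ≤ ε) :
    eLpNorm (s.indicator fun z => (m.map fun w => Real.log ‖z - w‖).sum) 1 μ ≤
      Multiset.card m * ε := by
  induction m using Multiset.induction_on with
  | empty => simp
  | cons a m ih =>
    simp only [Multiset.map_cons, Multiset.sum_cons, Multiset.card_cons]
    have e : (s.indicator fun z => Real.log ‖z - a‖ + (m.map fun w => Real.log ‖z - w‖).sum) =
      (s.indicator fun z => Real.log ‖z - a‖) +
        s.indicator fun z => (m.map fun w => Real.log ‖z - w‖).sum := Set.indicator_add _ _ _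
    rw [e]
    refine (eLpNorm_add_le ?_ ?_ le_rfl).trans ?_
    · exact ((by fun_prop : Measurable fun z : ℂ => Real.log ‖z - a‖).indicator
        hs).aestronglyMeasurable
    · exact ((measurable_multiset_sum_log_norm_sub m).indicator hs).aestronglyMeasurable
    · push_cast
      rw [add_mul, one_mul, add_comm]
      exact add_le_add (ih fun w hw => h w (Multiset.mem_cons_of_mem hw))
        (h a (Multiset.mem_cons_self a m))

/-- If the normalised potentials converge almost everywhere to a continuous function `V`, then the
integrals of logarithmic potentials against the empirical distributions of the solutions converge
to the integrals of `V`. -/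
theorem tendsto_integral_log_potential {z : ℕ → ℂ} {R : ℝ} (hz : ∀ k, ‖z k‖ ≤ R) {V : ℂ → ℝ}
    (hV : Continuous V)
    (hlim : ∀ᵐ w, Tendsto (fun n => solutionPotential z n w) atTop (𝓝 (V w)))
    {g : ℂ → ℝ} (hg : Continuous g) (hgc : HasCompactSupport g) :
    Tendsto (fun n => ∫ w, (∫ x, Real.log ‖x - w‖ * g x) ∂(solutionMeasure z n : Measure ℂ))
      atTop (𝓝 (∫ x, V x * g x)) := by
  set K := tsupport g with hKdef
  have hK : IsCompact K := hgc.isCompact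
  have : IsFiniteMeasure (volume.restrict K) := isFiniteMeasure_restrict.2 hK.measure_lt_top.ne
  set S : ℕ → ℂ → ℝ := fun n x =>
    (n : ℝ)⁻¹ * ((solutions z n).map fun v => Real.log ‖x - v‖).sum with hS
  have hint : ∀ m : Multiset ℂ,
      Integrable (fun x => (m.map fun v => Real.log ‖x - v‖).sum * g x) ∧
      ∫ x, (m.map fun v => Real.log ‖x - v‖).sum * g x =
        (m.map fun v => ∫ x, Real.log ‖x - v‖ * g x).sum := by
    intro m
    induction m using Multiset.induction_on with
    | empty => simp
    | cons a m ih =>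
      simp only [Multiset.map_cons, Multiset.sum_cons, add_mul]
      have hi := integrable_log_norm_sub_mul hg hgc a
      exact ⟨hi.add ih.1, by rw [integral_add hi ih.1, ih.2]⟩
  have hSmeas : ∀ n, Measurable (S n) := fun n =>
    (measurable_multiset_sum_log_norm_sub _).const_mul _
  have hSint : ∀ n, Integrable (fun x => S n x * g x) := by
    intro n
    simp only [hS, mul_assoc]
    exact (hint _).1.const_mul _
  have hSeq : ∀ n, ∫ w, (∫ x, Real.log ‖x - w‖ * g x) ∂(solutionMeasure z n : Measure ℂ) =
      ∫ x, S n x * g x := by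
    intro n
    rw [integral_solutionMeasure, ← (hint _).2, ← integral_const_mul]
    simp only [hS, mul_assoc]
  have hSlim : ∀ᵐ x ∂(volume.restrict K), Tendsto (fun n => S n x) atTop (𝓝 (V x)) := by
    refine ae_restrict_of_ae ?_
    have hne : ∀ᵐ x : ℂ, ∀ n, x ∉ solutions z n := by
      refine ae_all_iff.2 fun n => ?_
      have : {x | x ∈ solutions z n}.Finite := by
        refine (solutions z n).toFinset.finite_toSet.subset fun x hx => by simpa using hx
      exact (this.countable.ae_notMem volume)
    filter_upwards [hlim, hne] with x hx hxn
    exact hx.congr fun n => solutionPotential_eq_sum (hxn n)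
  have hui : UnifIntegrable S 1 (volume.restrict K) := by
    intro ε hε
    obtain ⟨δ, hδ, h⟩ := exists_eLpNorm_indicator_log_norm_sub_le hK (2 * R) hε
    refine ⟨δ, hδ, fun n s hs hsδ => ?_⟩
    have e : s.indicator (S n) = (n : ℝ)⁻¹ •
        s.indicator fun x => ((solutions z n).map fun v => Real.log ‖x - v‖).sum := by
      exact Set.indicator_const_smul s (n : ℝ)⁻¹ _
    rw [e, eLpNorm_const_smul]
    refine (mul_le_mul_right (eLpNorm_indicator_multiset_sum_le hs _ fun w hw =>
      h s hs hsδ w (norm_le_of_mem_solutions hz hw)) _).trans ?_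
    rw [card_solutions, ← mul_assoc]
    refine mul_le_of_le_one_left' ?_
    rcases Nat.eq_zero_or_pos n with rfl | hn
    · simp
    · rw [Real.enorm_of_nonneg (by positivity), ENNReal.ofReal_inv_of_pos (by positivity),
        ENNReal.ofReal_natCast]
      exact ENNReal.inv_mul_le_one _
  have hVL : MemLp V 1 (volume.restrict K) :=
    memLp_one_iff_integrable.2 (hV.continuousOn.integrableOn_compact hK)
  have hL1 := tendsto_Lp_finite_of_tendsto_ae le_rfl ENNReal.one_ne_top
    (fun n => (hSmeas n).aestronglyMeasurable) hVL hui hSlim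
  obtain ⟨M, hM⟩ := hgc.exists_bound_of_continuous hg
  have hrestrict : ∀ F : ℂ → ℝ, ∫ x, F x * g x = ∫ x in K, F x * g x := by
    intro F
    refine (setIntegral_eq_integral_of_forall_compl_eq_zero fun x hx => ?_).symm
    rw [image_eq_zero_of_notMem_tsupport hx, mul_zero]
  simp_rw [hSeq, hrestrict]
  refine tendsto_integral_of_L1' _ ((hV.mul hg).aestronglyMeasurable)
    (Eventually.of_forall fun n => (hSint n).restrict) ?_
  refine tendsto_of_tendsto_of_tendsto_of_le_of_le tendsto_const_nhds
    (h := fun n => ENNReal.ofReal M * eLpNorm (S n - V) 1 (volume.restrict K)) ?_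
    (fun _ => zero_le) fun n => ?_
  · simpa using ENNReal.Tendsto.const_mul hL1 (Or.inr ENNReal.ofReal_ne_top)
  · refine eLpNorm_le_mul_eLpNorm_of_ae_le_mul (Eventually.of_forall fun x => ?_) 1
    have : ((fun x => S n x * g x) - V * g) x = g x * (S n - V) x := by
      simp only [Pi.sub_apply, Pi.mul_apply]; ring
    rw [this, norm_mul]
    exact mul_le_mul_of_nonneg_right (hM x) (norm_nonneg _)

/-! ### Logarithmic potentials of measures with bounded density -/

theorem continuous_integral_norm_sub_mul {k g : ℂ → ℝ} (hk : LocallyIntegrable k)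
    (hg : Continuous g) (hgc : HasCompactSupport g) :
    Continuous fun w => ∫ x, k (w - x) * g x := by
  have h := hgc.continuous_convolution_right (ContinuousLinearMap.mul ℝ ℝ) hk hg
  refine h.congr fun w => ?_
  rw [convolution_def]
  simp only [ContinuousLinearMap.mul_apply']
  rw [← integral_sub_left_eq_self (fun x => k (w - x) * g x) volume w]
  simp

theorem integrable_of_continuous_of_ae_norm_le {μ : Measure ℂ} [IsFiniteMeasure μ] {R : ℝ}
    (hR : ∀ᵐ x ∂μ, ‖x‖ ≤ R) {h : ℂ → ℝ} (hh : Continuous h) : Integrable h μ := by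
  have hmem : ∀ᵐ x ∂μ, x ∈ Metric.closedBall (0 : ℂ) R := by simpa using hR
  rw [← Measure.restrict_eq_self_of_ae_mem hmem]
  exact hh.continuousOn.integrableOn_compact (isCompact_closedBall _ _)

/-- The logarithmic potential is symmetric: `∫ U^μ g = ∫ U^g dμ`. -/
theorem integral_logPotential_mul {μ : Measure ℂ} [IsFiniteMeasure μ] {R : ℝ}
    (hR : ∀ᵐ x ∂μ, ‖x‖ ≤ R) {g : ℂ → ℝ} (hg : Continuous g) (hgc : HasCompactSupport g) :
    Integrable (fun x => ∫ z, Real.log ‖z - x‖ * g z) μ ∧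
    ∫ z, logPotential μ z * g z = ∫ x, (∫ z, Real.log ‖z - x‖ * g z) ∂μ := by
  have hint : Integrable (fun p : ℂ × ℂ => Real.log ‖p.2 - p.1‖ * g p.2) (μ.prod volume) := by
    rw [integrable_prod_iff (by
      have h : Measurable fun p : ℂ × ℂ => Real.log ‖p.2 - p.1‖ * g p.2 := by fun_prop
      exact h.aestronglyMeasurable)]
    refine ⟨Eventually.of_forall fun x => integrable_log_norm_sub_mul hg hgc x, ?_⟩
    have hc := continuous_integral_norm_sub_mul (fun x => (locallyIntegrable_log_norm x).norm) hg.norm hgc.norm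
    refine integrable_of_continuous_of_ae_norm_le hR (hc.congr fun x => ?_)
    simp only [norm_mul, norm_sub_rev x]
  refine ⟨hint.integral_prod_left, ?_⟩
  rw [integral_integral_swap (f := fun x z => Real.log ‖z - x‖ * g z) hint]
  congr 1
  ext z
  rw [logPotential, integral_mul_const]
  simp only [norm_sub_rev z]

section Density

variable {μ : Measure ℂ} {f : ℂ → ℝ≥0}

theorem integrable_log_norm_sub (hf_cont : Continuous f) (hf_supp : HasCompactSupport f)
    (hμ : μ = (volume : Measure ℂ).withDensity (fun z => (f z : ℝ≥0∞))) (z : ℂ) :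
    Integrable (fun x => Real.log ‖x - z‖) μ := by
  rw [hμ, integrable_withDensity_iff_integrable_smul hf_cont.measurable]
  have := integrable_log_norm_sub_mul (g := fun x => (f x : ℝ)) (by fun_prop)
    (hf_supp.comp_left (g := fun t : ℝ≥0 => (t : ℝ)) rfl) z
  simpa [NNReal.smul_def, mul_comm] using this

theorem continuous_logPotential (hf_cont : Continuous f) (hf_supp : HasCompactSupport f)
    (hμ : μ = (volume : Measure ℂ).withDensity (fun z => (f z : ℝ≥0∞))) :
    Continuous (logPotential μ) := by
  have := continuous_integral_norm_sub_mul (g := fun x => (f x : ℝ)) locallyIntegrable_log_norm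
    (by fun_prop) (hf_supp.comp_left (g := fun t : ℝ≥0 => (t : ℝ)) rfl)
  refine this.congr fun z => ?_
  rw [logPotential, hμ, integral_withDensity_eq_integral_smul hf_cont.measurable]
  simp only [NNReal.smul_def, smul_eq_mul, norm_sub_rev z, mul_comm]

theorem exists_ae_norm_le (hf_supp : HasCompactSupport f) (hf_cont : Continuous f)
    (hμ : μ = (volume : Measure ℂ).withDensity (fun z => (f z : ℝ≥0∞))) :
    ∃ R : ℝ, ∀ᵐ x ∂μ, ‖x‖ ≤ R := by
  obtain ⟨R, hR⟩ := hf_supp.isCompact.isBounded.subset_closedBall 0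
  refine ⟨R, ?_⟩
  rw [hμ, ae_withDensity_iff (by fun_prop)]
  refine Eventually.of_forall fun x hx => ?_
  have hx' : x ∈ tsupport f := subset_tsupport _ (by simpa using hx)
  simpa using hR hx'

theorem exists_measure_le_mul_volume (hf_cont : Continuous f) (hf_supp : HasCompactSupport f)
    (hμ : μ = (volume : Measure ℂ).withDensity (fun z => (f z : ℝ≥0∞))) :
    ∃ M : ℝ≥0, ∀ s, μ s ≤ M * volume s := by
  obtain ⟨M, hM⟩ := (hf_supp.isCompact_range hf_cont).bddAbove
  refine ⟨M, fun s => ?_⟩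
  have h : μ ≤ (M : ℝ≥0∞) • (volume : Measure ℂ) := by
    rw [hμ, ← withDensity_const]
    exact withDensity_mono (Eventually.of_forall fun x => by
      exact ENNReal.coe_le_coe.2 (hM (Set.mem_range_self x)))
  simpa using h s

end Density

/-! ### Exponential growth rates -/

theorem eventually_exp_le_of_tendsto_log {a : ℕ → ℝ} {α : ℝ} (ha : ∀ n, 0 < a n)
    (h : Tendsto (fun n : ℕ => (n : ℝ)⁻¹ * Real.log (a n)) atTop (𝓝 α)) {ε : ℝ} (hε : 0 < ε) :
    ∀ᶠ n : ℕ in atTop, Real.exp (n * (α - ε)) ≤ a n ∧ a n ≤ Real.exp (n * (α + ε)) := by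
  filter_upwards [h.eventually (Icc_mem_nhds (sub_lt_self α hε) (lt_add_of_pos_right α hε)),
    eventually_gt_atTop 0] with n hn hn0
  have hn' : (0 : ℝ) < n := by exact_mod_cast hn0
  rw [le_inv_mul_iff₀ hn', inv_mul_le_iff₀ hn'] at hn
  exact ⟨(Real.le_log_iff_exp_le (ha n)).1 hn.1, (Real.log_le_iff_le_exp (ha n)).1 hn.2⟩

theorem tendsto_log_of_eventually_exp_le {d : ℕ → ℝ} {γ : ℝ}
    (h : ∀ ε > 0, ∀ᶠ n : ℕ in atTop, Real.exp (n * (γ - ε)) ≤ d n ∧ d n ≤ Real.exp (n * (γ + ε))) :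
    Tendsto (fun n : ℕ => (n : ℝ)⁻¹ * Real.log (d n)) atTop (𝓝 γ) := by
  rw [Metric.tendsto_nhds]
  intro ε hε
  filter_upwards [h (ε / 2) (half_pos hε), eventually_gt_atTop 0] with n hn hn0
  have hn' : (0 : ℝ) < n := by exact_mod_cast hn0
  have hd : 0 < d n := (Real.exp_pos _).trans_le hn.1
  have h1 := (Real.le_log_iff_exp_le hd).2 hn.1
  have h2 := (Real.log_le_iff_le_exp hd).2 hn.2
  rw [← le_inv_mul_iff₀ hn'] at h1
  rw [← inv_mul_le_iff₀ hn'] at h2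
  rw [Real.dist_eq, abs_lt]
  constructor <;> linarith

theorem eventually_le_exp_mul (C : ℝ) {ε : ℝ} (hε : 0 < ε) :
    ∀ᶠ n : ℕ in atTop, C ≤ Real.exp (n * ε) := by
  have : Tendsto (fun n : ℕ => Real.exp (n * ε)) atTop atTop :=
    Real.tendsto_exp_atTop.comp (tendsto_natCast_atTop_atTop.atTop_mul_const hε)
  exact this.eventually_ge_atTop C

/-- The growth rate of a difference is the larger of the two growth rates. When the first rate does
not exceed the second, cancellation has to be excluded by hypothesis. -/
theorem tendsto_log_norm_sub {a b : ℕ → ℂ} {α β : ℝ} (ha0 : ∀ n, a n ≠ 0) (hb0 : ∀ n, b n ≠ 0)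
    (ha : Tendsto (fun n : ℕ => (n : ℝ)⁻¹ * Real.log ‖a n‖) atTop (𝓝 α))
    (hb : Tendsto (fun n : ℕ => (n : ℝ)⁻¹ * Real.log ‖b n‖) atTop (𝓝 β))
    (hlow : ∀ ε > 0, ∀ᶠ n : ℕ in atTop, Real.exp (n * (β - ε)) ≤ ‖a n - b n‖) :
    Tendsto (fun n : ℕ => (n : ℝ)⁻¹ * Real.log ‖a n - b n‖) atTop (𝓝 (max α β)) := by
  have hA := fun ε hε => eventually_exp_le_of_tendsto_log (ε := ε)
    (fun n => norm_pos_iff.2 (ha0 n)) ha hε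
  have hB := fun ε hε => eventually_exp_le_of_tendsto_log (ε := ε)
    (fun n => norm_pos_iff.2 (hb0 n)) hb hε
  refine tendsto_log_of_eventually_exp_le fun ε hε => Eventually.and ?_ ?_
  · rcases le_or_gt α β with h | h
    · rw [max_eq_right h]
      exact hlow ε hε
    · rw [max_eq_left h.le]
      obtain ⟨η, hη, hηε, hηαβ⟩ : ∃ η : ℝ, 0 < η ∧ 2 * η ≤ ε ∧ 3 * η ≤ α - β :=
        ⟨min (ε / 2) ((α - β) / 3), lt_min (by positivity) (by linarith),
          by linarith [min_le_left (ε / 2) ((α - β) / 3)],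
          by linarith [min_le_right (ε / 2) ((α - β) / 3)]⟩
      filter_upwards [hA η hη, hB η hη, eventually_le_exp_mul 2 hη] with n h1 h2 h3
      have hn : (0 : ℝ) ≤ n := n.cast_nonneg
      have e1 : Real.exp (n * (α - η)) =
          Real.exp (n * η) * Real.exp (n * (α - 2 * η)) := by
        rw [← Real.exp_add]; ring_nf
      have e2 : Real.exp (n * (β + η)) ≤ Real.exp (n * (α - 2 * η)) :=
        Real.exp_le_exp.2 (mul_le_mul_of_nonneg_left (by linarith) hn)
      have e3 : Real.exp (n * (α - ε)) ≤ Real.exp (n * (α - 2 * η)) :=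
        Real.exp_le_exp.2 (mul_le_mul_of_nonneg_left (by linarith) hn)
      have e4 : 2 * Real.exp (n * (α - 2 * η)) ≤ Real.exp (n * η) * Real.exp (n * (α - 2 * η)) :=
        mul_le_mul_of_nonneg_right h3 (Real.exp_pos _).le
      linarith [norm_sub_norm_le (a n) (b n), h1.1, h2.2]
  · filter_upwards [hA (ε / 2) (half_pos hε), hB (ε / 2) (half_pos hε),
      eventually_le_exp_mul 2 (half_pos hε)] with n h1 h2 h3
    have hn : (0 : ℝ) ≤ n := n.cast_nonneg
    have e1 : Real.exp (n * (max α β + ε)) =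
        Real.exp (n * (ε / 2)) * Real.exp (n * (max α β + ε / 2)) := by
      rw [← Real.exp_add]; ring_nf
    have e2 : Real.exp (n * (α + ε / 2)) ≤ Real.exp (n * (max α β + ε / 2)) :=
      Real.exp_le_exp.2 (mul_le_mul_of_nonneg_left (by linarith [le_max_left α β]) hn)
    have e3 : Real.exp (n * (β + ε / 2)) ≤ Real.exp (n * (max α β + ε / 2)) :=
      Real.exp_le_exp.2 (mul_le_mul_of_nonneg_left (by linarith [le_max_right α β]) hn)
    have e4 : 2 * Real.exp (n * (max α β + ε / 2)) ≤
        Real.exp (n * (ε / 2)) * Real.exp (n * (max α β + ε / 2)) :=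
      mul_le_mul_of_nonneg_right h3 (Real.exp_pos _).le
    linarith [norm_sub_le (a n) (b n), h1.2, h2.2]

/-! ### Random roots -/

section Random

variable {μ : Measure ℂ} [IsProbabilityMeasure μ]

theorem ae_forall_infinitePi {p : ℂ → Prop} (hp : ∀ᵐ x ∂μ, p x) :
    ∀ᵐ ω ∂(Measure.infinitePi fun _ : ℕ => μ), ∀ k, p (ω k) :=
  ae_all_iff.2 fun k =>
    (measurePreserving_eval_infinitePi (fun _ : ℕ => μ) k).quasiMeasurePreserving.ae hp

theorem iIndepFun_eval_infinitePi :
    iIndepFun (fun (k : ℕ) (ω : ℕ → ℂ) => ω k) (Measure.infinitePi fun _ : ℕ => μ) :=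
  iIndepFun_infinitePi (X := fun (_ : ℕ) (x : ℂ) => x) fun _ => measurable_id

theorem ae_forall_eval_rootPoly_ne_zero {w : ℂ} (hw : μ {w} = 0) :
    ∀ᵐ ω ∂(Measure.infinitePi fun _ : ℕ => μ), ∀ n, (rootPoly ω n).eval w ≠ 0 := by
  filter_upwards [ae_forall_infinitePi (measure_eq_zero_iff_ae_notMem.1 hw)] with ω hω n
  rw [eval_rootPoly, Finset.prod_ne_zero_iff]
  exact fun k _ h => hω k (by simp [sub_eq_zero.1 h])

/-- Strong law of large numbers: `(1/n) log |p_n(z)|` tends to the logarithmic potential. -/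
theorem ae_tendsto_log_norm_rootPoly {z : ℂ} (hint : Integrable (fun x => Real.log ‖x - z‖) μ)
    (hz : μ {z} = 0) :
    ∀ᵐ ω ∂(Measure.infinitePi fun _ : ℕ => μ),
      Tendsto (fun n : ℕ => (n : ℝ)⁻¹ * Real.log ‖(rootPoly ω n).eval z‖) atTop
        (𝓝 (logPotential μ z)) := by
  have hmp := fun k : ℕ => measurePreserving_eval_infinitePi (fun _ : ℕ => μ) k
  have hmeas : Measurable fun x : ℂ => Real.log ‖x - z‖ := by fun_prop
  have hlaw := strong_law_ae_real (μ := Measure.infinitePi fun _ : ℕ => μ)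
    (fun k ω => Real.log ‖ω k - z‖)
    ((hmp 0).integrable_comp_of_integrable hint)
    (fun i j hij => ((iIndepFun_eval_infinitePi (μ := μ)).comp (fun _ x => Real.log ‖x - z‖)
      fun _ => hmeas).indepFun hij)
    (fun i => ⟨(hmeas.comp (measurable_pi_apply i)).aemeasurable,
      (hmeas.comp (measurable_pi_apply 0)).aemeasurable, by
      have h := fun k => Measure.map_map (μ := Measure.infinitePi fun _ : ℕ => μ) hmeas
        (hmp k).measurable
      simp only [(hmp _).map_eq] at h
      exact (h i).symm.trans (h 0)⟩)
  have hE : ∫ ω, Real.log ‖ω 0 - z‖ ∂(Measure.infinitePi fun _ : ℕ => μ) = logPotential μ z := by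
    have h := integral_map (hmp 0).measurable.aemeasurable
      (hmeas.aestronglyMeasurable (μ := (Measure.infinitePi fun _ : ℕ => μ).map (Function.eval 0)))
    rw [(hmp 0).map_eq] at h
    exact h.symm
  rw [hE] at hlaw
  filter_upwards [hlaw, ae_forall_infinitePi (measure_eq_zero_iff_ae_notMem.1 hz)] with ω h1 h2
  refine h1.congr fun n => ?_
  rw [eval_rootPoly, norm_prod, Real.log_prod, div_eq_inv_mul]
  · simp only [norm_sub_rev z]
  · intro k _
    rw [norm_ne_zero_iff, sub_ne_zero]
    exact fun h => h2 k (by simp [h])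

theorem eval_rootPoly_succ_sub (ω : ℕ → ℂ) (n : ℕ) (z : ℂ) :
    (rootPoly ω (n + 1)).eval z - (rootPoly ω (n + 1)).eval 0 =
      z * (rootPoly ω n).eval z -
        ω n * ((rootPoly ω n).eval z - (rootPoly ω n).eval 0) := by
  simp only [eval_rootPoly, Finset.prod_range_succ]
  ring

theorem measurable_eval_rootPoly (n : ℕ) :
    Measurable fun p : (ℕ → ℂ) × ℂ => (rootPoly p.1 n).eval p.2 := by
  simp only [eval_rootPoly]
  fun_prop

/-- Anticoncentration: conditionally on the first `n` roots, `p_{n+1}(z) - p_{n+1}(0)` is an affine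
function of the root `z_n`, which has a bounded density. -/
theorem measure_affine_lt_le {M : ℝ≥0} (hM : ∀ s, μ s ≤ M * volume s) (z : ℂ) (n : ℕ) {s : ℝ}
    (hs : 0 < s) (t : ℝ) :
    (Measure.infinitePi fun _ : ℕ => μ)
      {ω | s ≤ ‖(rootPoly ω n).eval z - (rootPoly ω n).eval 0‖ ∧
        ‖(rootPoly ω (n + 1)).eval z - (rootPoly ω (n + 1)).eval 0‖ < t} ≤
      M * (ENNReal.ofReal (t / s) ^ 2 * NNReal.pi) := by
  set X : (ℕ → ℂ) → ℂ × ℂ := fun ω =>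
    (z * (rootPoly ω n).eval z, (rootPoly ω n).eval z - (rootPoly ω n).eval 0) with hX
  have hXm : Measurable X := by
    simp only [hX, eval_rootPoly]
    fun_prop
  have hmp := measurePreserving_eval_infinitePi (fun _ : ℕ => μ) n
  have hind : IndepFun X (fun ω => ω n) (Measure.infinitePi fun _ : ℕ => μ) := by
    have h := (iIndepFun_eval_infinitePi (μ := μ)).indepFun_finset (Finset.range n) {n} (by simp)
      (fun i => measurable_pi_apply i)
    let G : (Finset.range n → ℂ) → ℂ × ℂ := fun v =>
      (z * ∏ k, (z - v k), ∏ k, (z - v k) - ∏ k, (0 - v k))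
    let H : (({n} : Finset ℕ) → ℂ) → ℂ := fun v => v ⟨n, by simp⟩
    have := h.comp (φ := G) (ψ := H) (by fun_prop) (by fun_prop)
    have hXG : X = G ∘ fun ω i => ω i := ?_
    · rw [hXG]; exact this
    ext ω : 1
    simp only [hX, G, eval_rootPoly, Function.comp_apply]
    rw [Finset.prod_coe_sort (Finset.range n) (fun k => z - ω k),
      Finset.prod_coe_sort (Finset.range n) (fun k => 0 - ω k)]
  have hprod := (indepFun_iff_map_prod_eq_prod_map_map hXm.aemeasurable
    hmp.measurable.aemeasurable).1 hind
  set S : Set ((ℂ × ℂ) × ℂ) := {p | s ≤ ‖p.1.2‖ ∧ ‖p.1.1 - p.2 * p.1.2‖ < t} with hS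
  have hSm : MeasurableSet S :=
    MeasurableSet.inter
      (measurableSet_le (f := fun _ : (ℂ × ℂ) × ℂ => s) measurable_const
        (g := fun p => ‖p.1.2‖) (by fun_prop))
      (measurableSet_lt (f := fun p : (ℂ × ℂ) × ℂ => ‖p.1.1 - p.2 * p.1.2‖) (by fun_prop)
        (g := fun _ => t) measurable_const)
  have hset : {ω | s ≤ ‖(rootPoly ω n).eval z - (rootPoly ω n).eval 0‖ ∧
        ‖(rootPoly ω (n + 1)).eval z - (rootPoly ω (n + 1)).eval 0‖ < t} =
      (fun ω => (X ω, ω n)) ⁻¹' S := by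
    ext ω
    simp only [eval_rootPoly_succ_sub, hS, hX, Set.mem_ofPred_eq, Set.mem_preimage]
  have hfib : ∀ x : ℂ × ℂ, μ (Prod.mk x ⁻¹' S) ≤ M * (ENNReal.ofReal (t / s) ^ 2 * NNReal.pi) := by
    intro x
    by_cases hx : s ≤ ‖x.2‖
    · rw [← Complex.volume_ball (x.1 / x.2) (t / s)]
      refine (measure_mono fun y hy => ?_).trans (hM _)
      have hx2 : 0 < ‖x.2‖ := hs.trans_le hx
      have hy2 : ‖x.1 - y * x.2‖ < t := hy.2
      have ht : 0 ≤ t := (norm_nonneg _).trans hy2.le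
      rw [mem_ball_iff_norm, norm_sub_rev]
      have e : x.1 / x.2 - y = (x.1 - y * x.2) / x.2 := by
        field_simp [norm_pos_iff.1 hx2]
      rw [e, norm_div]
      calc ‖x.1 - y * x.2‖ / ‖x.2‖ < t / ‖x.2‖ := div_lt_div_of_pos_right hy2 hx2
        _ ≤ t / s := div_le_div_of_nonneg_left ht hs hx
    · have : Prod.mk x ⁻¹' S = ∅ := Set.eq_empty_of_forall_notMem fun y hy => hx hy.1
      rw [this, measure_empty]
      exact zero_le
  have : IsProbabilityMeasure ((Measure.infinitePi fun _ : ℕ => μ).map X) :=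
    Measure.isProbabilityMeasure_map hXm.aemeasurable
  have hmap : (Measure.infinitePi fun _ : ℕ => μ).map (fun ω => ω n) = μ := hmp.map_eq
  rw [hset, ← Measure.map_apply (hXm.prodMk (measurable_pi_apply n)) hSm, hprod, hmap,
    Measure.prod_apply hSm]
  calc ∫⁻ x, μ (Prod.mk x ⁻¹' S) ∂((Measure.infinitePi fun _ : ℕ => μ).map X)
      ≤ ∫⁻ _, M * (ENNReal.ofReal (t / s) ^ 2 * NNReal.pi)
        ∂((Measure.infinitePi fun _ : ℕ => μ).map X) := lintegral_mono hfib
    _ = _ := by simp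

/-- Almost surely no exponential cancellation below `|p_n(0)|` occurs in `p_n(z) - p_n(0)`. -/
theorem ae_eventually_exp_le_norm_sub {M : ℝ≥0} (hM : ∀ s, μ s ≤ M * volume s) {R : ℝ}
    (hR : ∀ᵐ x ∂μ, ‖x‖ ≤ R) {z : ℂ} (hz : z ≠ 0)
    (hint : Integrable (fun x => Real.log ‖x - 0‖) μ) {ε : ℝ} (hε : 0 < ε) :
    ∀ᵐ ω ∂(Measure.infinitePi fun _ : ℕ => μ), ∀ᶠ n : ℕ in atTop,
      Real.exp (n * (logPotential μ 0 - 4 * ε)) ≤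
        ‖(rootPoly ω n).eval z - (rootPoly ω n).eval 0‖ := by
  have h0 : μ {(0 : ℂ)} = 0 := le_antisymm ((hM _).trans (by simp)) zero_le
  set β := logPotential μ 0 with hβ
  set F : ℕ → Set (ℕ → ℂ) := fun n =>
    {ω | Real.exp (n * (β - 2 * ε)) ≤ ‖(rootPoly ω n).eval z - (rootPoly ω n).eval 0‖ ∧
      ‖(rootPoly ω (n + 1)).eval z - (rootPoly ω (n + 1)).eval 0‖ < Real.exp (n * (β - 3 * ε))}
    with hF
  have hsum : ∑' n, (Measure.infinitePi fun _ : ℕ => μ) (F n) ≠ ∞ := by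
    have hle : ∀ n, (Measure.infinitePi fun _ : ℕ => μ) (F n) ≤
        M * NNReal.pi * ENNReal.ofReal (Real.exp (-(2 * ε))) ^ n := fun n => by
      refine (measure_affine_lt_le hM z n (Real.exp_pos _) _).trans (le_of_eq ?_)
      rw [← Real.exp_sub, mul_assoc, mul_comm _ (NNReal.pi : ℝ≥0∞),
        ← ENNReal.ofReal_pow (Real.exp_pos _).le, ← ENNReal.ofReal_pow (Real.exp_pos _).le,
        ← Real.exp_nat_mul, ← Real.exp_nat_mul]
      congr 4
      push_cast
      ring
    refine ne_top_of_le_ne_top ?_ (ENNReal.tsum_le_tsum hle)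
    rw [ENNReal.tsum_mul_left, ENNReal.tsum_geometric]
    refine ENNReal.mul_ne_top (ENNReal.mul_ne_top ENNReal.coe_ne_top ENNReal.coe_ne_top) ?_
    rw [ENNReal.inv_ne_top, ne_eq, tsub_eq_zero_iff_le, not_le, ENNReal.ofReal_lt_one, Real.exp_lt_one_iff]
    linarith
  filter_upwards [ae_eventually_notMem hsum, ae_tendsto_log_norm_rootPoly hint h0,
    ae_forall_eval_rootPoly_ne_zero h0,
    ae_forall_infinitePi hR] with ω hBC hlim hω0 hωR
  have hpos : ∀ n, 0 < ‖(rootPoly ω n).eval 0‖ := fun n => by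
    exact norm_pos_iff.2 (hω0 n)
  have hzpos : 0 < ‖z‖ := norm_pos_iff.2 hz
  have hR0 : 0 ≤ R := (norm_nonneg _).trans (hωR 0)
  rw [← map_add_atTop_eq_nat 1, eventually_map]
  filter_upwards [hBC, eventually_exp_le_of_tendsto_log hpos hlim hε,
    eventually_le_exp_mul ((1 + R + ‖z‖) / ‖z‖) hε, eventually_le_exp_mul (Real.exp (β - 4 * ε)) hε]
    with n h1 h2 h3 h4
  -- The spare `ε` in the exponent absorbs the shift from `n` to `n + 1`.
  have hstep : Real.exp (((n + 1 : ℕ) : ℝ) * (β - 4 * ε)) ≤ Real.exp (n * (β - 3 * ε)) := by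
    have := mul_le_mul_of_nonneg_right h4 (Real.exp_pos (n * (β - 4 * ε))).le
    rw [← Real.exp_add, ← Real.exp_add] at this
    refine le_of_eq_of_le ?_ (this.trans (le_of_eq ?_)) <;> congr 1 <;> push_cast <;> ring
  refine hstep.trans ?_
  by_contra! hlt
  set q := (rootPoly ω n).eval z - (rootPoly ω n).eval 0 with hq
  -- Off the Borel-Cantelli event the slope `q` of the affine function must be small.
  have hqs : ‖q‖ < Real.exp (n * (β - 2 * ε)) := by
    by_contra! hge
    exact h1 ⟨hge, hlt⟩
  rw [eval_rootPoly_succ_sub, ← hq] at hlt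
  have hts : Real.exp (n * (β - 3 * ε)) ≤ Real.exp (n * (β - 2 * ε)) :=
    Real.exp_le_exp.2 (mul_le_mul_of_nonneg_left (by linarith) n.cast_nonneg)
  have hsplit : z * (rootPoly ω n).eval 0 =
      (z * (rootPoly ω n).eval z - ω n * q) + ω n * q - z * q := by
    rw [hq]; ring
  have hbound : ‖z‖ * ‖(rootPoly ω n).eval 0‖ <
      (1 + R + ‖z‖) * Real.exp (n * (β - 2 * ε)) := by
    rw [← norm_mul, hsplit]
    have n1 := norm_sub_le ((z * (rootPoly ω n).eval z - ω n * q) + ω n * q) (z * q)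
    have n2 := norm_add_le (z * (rootPoly ω n).eval z - ω n * q) (ω n * q)
    rw [norm_mul] at n1 n2
    have n3 : ‖ω n‖ * ‖q‖ ≤ R * Real.exp (n * (β - 2 * ε)) :=
      mul_le_mul (hωR n) hqs.le (norm_nonneg _) hR0
    have n4 : ‖z‖ * ‖q‖ ≤ ‖z‖ * Real.exp (n * (β - 2 * ε)) :=
      mul_le_mul_of_nonneg_left hqs.le hzpos.le
    linarith
  have hfinal : (1 + R + ‖z‖) * Real.exp (n * (β - 2 * ε)) ≤
      ‖z‖ * ‖(rootPoly ω n).eval 0‖ := by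
    rw [div_le_iff₀ hzpos] at h3
    calc (1 + R + ‖z‖) * Real.exp (n * (β - 2 * ε))
        ≤ (Real.exp (n * ε) * ‖z‖) * Real.exp (n * (β - 2 * ε)) :=
          mul_le_mul_of_nonneg_right h3 (Real.exp_pos _).le
      _ = ‖z‖ * Real.exp (n * (β - ε)) := by
          rw [mul_comm (Real.exp _) ‖z‖, mul_assoc, ← Real.exp_add]
          ring_nf
      _ ≤ _ := mul_le_mul_of_nonneg_left h2.1 hzpos.le
  exact absurd hbound (not_lt.2 hfinal)

theorem ae_tendsto_solutionPotential {M : ℝ≥0} (hM : ∀ s, μ s ≤ M * volume s) {R : ℝ}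
    (hR : ∀ᵐ x ∂μ, ‖x‖ ≤ R) (hint : ∀ z, Integrable (fun x => Real.log ‖x - z‖) μ)
    {z : ℂ} (hz : z ≠ 0) :
    ∀ᵐ ω ∂(Measure.infinitePi fun _ : ℕ => μ),
      Tendsto (fun n => solutionPotential ω n z) atTop
        (𝓝 (max (logPotential μ z) (logPotential μ 0))) := by
  have hnull : ∀ w : ℂ, μ {w} = 0 := fun w => le_antisymm ((hM _).trans (by simp)) zero_le
  have hlow : ∀ᵐ ω ∂(Measure.infinitePi fun _ : ℕ => μ), ∀ m : ℕ, ∀ᶠ n : ℕ in atTop,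
      Real.exp (n * (logPotential μ 0 - 4 * (1 / ((m : ℝ) + 1)))) ≤
        ‖(rootPoly ω n).eval z - (rootPoly ω n).eval 0‖ :=
    ae_all_iff.2 fun m => ae_eventually_exp_le_norm_sub hM hR hz (hint 0) (by positivity)
  filter_upwards [hlow, ae_forall_eval_rootPoly_ne_zero (hnull z),
    ae_forall_eval_rootPoly_ne_zero (hnull 0), ae_tendsto_log_norm_rootPoly (hint z) (hnull z),
    ae_tendsto_log_norm_rootPoly (hint 0) (hnull 0)] with ω h1 h2 h3 h4 h5
  refine tendsto_log_norm_sub h2 h3 h4 h5 fun ε hε => ?_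
  obtain ⟨m, hm⟩ := exists_nat_one_div_lt (show 0 < ε / 4 by positivity)
  filter_upwards [h1 m] with n hn
  refine (Real.exp_le_exp.2 (mul_le_mul_of_nonneg_left ?_ n.cast_nonneg)).trans hn
  linarith

/-- Almost surely, the normalised potentials converge almost everywhere in the plane. -/
theorem ae_ae_tendsto_solutionPotential {M : ℝ≥0} (hM : ∀ s, μ s ≤ M * volume s) {R : ℝ}
    (hR : ∀ᵐ x ∂μ, ‖x‖ ≤ R) (hint : ∀ z, Integrable (fun x => Real.log ‖x - z‖) μ)
    (hcont : Continuous (logPotential μ)) :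
    ∀ᵐ ω ∂(Measure.infinitePi fun _ : ℕ => μ), ∀ᵐ z : ℂ,
      Tendsto (fun n => solutionPotential ω n z) atTop
        (𝓝 (max (logPotential μ z) (logPotential μ 0))) := by
  rw [Measure.ae_ae_comm]
  · filter_upwards [(Set.countable_singleton (0 : ℂ)).ae_notMem volume] with z hz
    exact ae_tendsto_solutionPotential hM hR hint hz
  · refine measurableSet_tendsto_fun (fun n => ?_) ?_
    · have h1 := measurable_eval_rootPoly n
      have h2 : Measurable fun p : (ℕ → ℂ) × ℂ => (rootPoly p.1 n).eval 0 :=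
        h1.comp (measurable_fst.prodMk measurable_const)
      unfold solutionPotential
      fun_prop
    · exact (hcont.measurable.comp measurable_snd).max measurable_const

end Random

/-! ### Limits of the empirical distributions -/

section Limit

variable {z : ℕ → ℂ} {R : ℝ} {V : ℂ → ℝ}

theorem eventually_abs_integral_solutionMeasure_sub_le (hz : ∀ k, ‖z k‖ ≤ R) (hV : Continuous V)
    (hlim : ∀ᵐ w, Tendsto (fun n => solutionPotential z n w) atTop (𝓝 (V w)))
    {φ g : ℂ → ℝ} (hg : Continuous g) (hgc : HasCompactSupport g) {ε : ℝ} (hε : 0 < ε)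
    (hgφ : ∀ w, |(∫ x, Real.log ‖x - w‖ * g x) - φ w| ≤ ε) :
    ∀ᶠ n in atTop, |(∫ w, φ w ∂(solutionMeasure z n : Measure ℂ)) - ∫ x, V x * g x| ≤ 2 * ε := by
  have h := (Metric.tendsto_nhds.1 (tendsto_integral_log_potential hz hV hlim hg hgc)) ε hε
  filter_upwards [h, eventually_gt_atTop 0] with n hn hn0
  rw [Real.dist_eq] at hn
  have hi := integrable_solutionMeasure z n φ
  have hj := integrable_solutionMeasure z n fun w => ∫ x, Real.log ‖x - w‖ * g x
  have hd : |(∫ w, (∫ x, Real.log ‖x - w‖ * g x) ∂(solutionMeasure z n : Measure ℂ)) -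
      ∫ w, φ w ∂(solutionMeasure z n : Measure ℂ)| ≤ ε := by
    rw [← integral_sub hj hi]
    have hb := norm_integral_le_of_norm_le_const (μ := (solutionMeasure z n : Measure ℂ))
      (f := fun w => (∫ x, Real.log ‖x - w‖ * g x) - φ w) (Eventually.of_forall hgφ)
    have hmass : (solutionMeasure z n : Measure ℂ).real Set.univ = 1 := by
      have := mass_solutionMeasure z hn0
      rw [← NNReal.coe_inj, NNReal.coe_one] at this
      exact this
    rwa [hmass, mul_one] at hb
  rw [abs_le] at hd ⊢
  rw [abs_lt] at hn
  constructor <;> linarith [hd.1, hd.2, hn.1, hn.2]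

/-- The empirical distributions of the solutions have a cluster point, since they all live on one
disc. -/
theorem exists_cluster_solutionMeasure (hz : ∀ k, ‖z k‖ ≤ R) :
    ∃ (ν : ProbabilityMeasure ℂ) (F : Ultrafilter ℕ), (F : Filter ℕ) ≤ atTop ∧
      (ν : Measure ℂ) (Metric.closedBall 0 (2 * R))ᶜ = 0 ∧
      Tendsto (solutionMeasure z) F (𝓝 ν.toFiniteMeasure) := by
  have hK := isCompact_setOfPred_finiteMeasure_le_of_isCompact (E := ℂ) 1
    (isCompact_closedBall (0 : ℂ) (2 * R))
  have hmem : ∀ᶠ n in atTop, solutionMeasure z n ∈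
      {ν : FiniteMeasure ℂ | ν.mass ≤ 1 ∧ ν (Metric.closedBall 0 (2 * R))ᶜ = 0} := by
    filter_upwards [eventually_gt_atTop 0] with n hn
    exact ⟨(mass_solutionMeasure z hn).le, solutionMeasure_compl_closedBall hz n⟩
  obtain ⟨ν, hν, hcl⟩ := hK (f := map (solutionMeasure z) atTop)
    (le_principal_iff.2 (mem_map.2 hmem))
  obtain ⟨F, hF, hFν⟩ := mapClusterPt_iff_ultrafilter.1 hcl
  have hmass : ν.mass = 1 := by
    refine tendsto_nhds_unique ((FiniteMeasure.continuous_mass.tendsto ν).comp hFν) ?_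
    refine tendsto_const_nhds.congr' (hF ?_)
    filter_upwards [eventually_gt_atTop 0] with n hn
    exact (mass_solutionMeasure z hn).symm
  have hprob : IsProbabilityMeasure (ν : Measure ℂ) := by
    constructor
    rw [← FiniteMeasure.ennreal_mass, hmass, ENNReal.coe_one]
  refine ⟨⟨ν, hprob⟩, F, hF, ?_, ?_⟩
  · exact (FiniteMeasure.null_iff_toMeasure_null ν _).1 hν.2
  · exact hFν

theorem tendsto_integral_of_tendsto_finiteMeasure {ι : Type*} {F : Filter ι}
    {νs : ι → FiniteMeasure ℂ} {ν : FiniteMeasure ℂ} (h : Tendsto νs F (𝓝 ν)) {φ : ℂ → ℝ}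
    (hφ : Continuous φ) (hφc : HasCompactSupport φ) :
    Tendsto (fun i => ∫ x, φ x ∂(νs i : Measure ℂ)) F (𝓝 (∫ x, φ x ∂(ν : Measure ℂ))) := by
  obtain ⟨M, hM⟩ := hφc.exists_bound_of_continuous hφ
  exact FiniteMeasure.tendsto_iff_forall_integral_tendsto.1 h
    (BoundedContinuousFunction.ofNormedAddCommGroup φ hφ M hM)

/-- The integrals of a test function against a cluster point are determined by `V`. -/
theorem abs_integral_cluster_sub_le (hz : ∀ k, ‖z k‖ ≤ R) (hV : Continuous V)
    (hlim : ∀ᵐ w, Tendsto (fun n => solutionPotential z n w) atTop (𝓝 (V w)))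
    {ν : ProbabilityMeasure ℂ} {F : Ultrafilter ℕ} (hF : (F : Filter ℕ) ≤ atTop)
    (hν : Tendsto (solutionMeasure z) F (𝓝 ν.toFiniteMeasure))
    {φ g : ℂ → ℝ} (hφ : Continuous φ) (hφc : HasCompactSupport φ)
    (hg : Continuous g) (hgc : HasCompactSupport g) {ε : ℝ} (hε : 0 < ε)
    (hgφ : ∀ w, |(∫ x, Real.log ‖x - w‖ * g x) - φ w| ≤ ε) :
    |(∫ w, φ w ∂(ν : Measure ℂ)) - ∫ x, V x * g x| ≤ 2 * ε :=
  le_of_tendsto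
    (((tendsto_integral_of_tendsto_finiteMeasure hν hφ hφc).sub_const (∫ x, V x * g x)).abs)
    (hF (eventually_abs_integral_solutionMeasure_sub_le hz hV hlim hg hgc hε hgφ))

/-- A measure whose integrals of test functions are determined by `V`, and which lives on the disc
containing all solutions, is the weak limit of every sequence of empirical distributions with
limiting potential `V`. -/
theorem tendsto_solutionMeasure (hz : ∀ k, ‖z k‖ ≤ R) (hV : Continuous V)
    (hlim : ∀ᵐ w, Tendsto (fun n => solutionPotential z n w) atTop (𝓝 (V w)))
    {ν : ProbabilityMeasure ℂ} (hνR : (ν : Measure ℂ) (Metric.closedBall 0 (2 * R))ᶜ = 0)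
    (hν : ∀ φ g : ℂ → ℝ, Continuous φ → HasCompactSupport φ → Continuous g →
      HasCompactSupport g → ∀ ε > 0, (∀ w, |(∫ x, Real.log ‖x - w‖ * g x) - φ w| ≤ ε) →
      |(∫ w, φ w ∂(ν : Measure ℂ)) - ∫ x, V x * g x| ≤ 2 * ε) :
    Tendsto (solutionMeasure z) atTop (𝓝 ν.toFiniteMeasure) := by
  rw [FiniteMeasure.tendsto_iff_forall_integral_tendsto]
  intro f
  -- The cutoff `χ` equals one on the disc carrying all the measures.
  set χ : ℂ → ℝ := fun w => max 0 (min 1 (2 * R + 1 - ‖w‖)) with hχ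
  have hφ : Continuous fun w => f w * χ w := by fun_prop
  have hφc : HasCompactSupport fun w => f w * χ w := by
    refine HasCompactSupport.of_support_subset_isCompact
      (isCompact_closedBall (0 : ℂ) (2 * R + 1)) fun w hw => ?_
    by_contra hcon
    rw [mem_closedBall_zero_iff, not_le] at hcon
    refine hw ?_
    have : χ w = 0 := max_eq_left ((min_le_right _ _).trans (by linarith))
    simp [this]
  have hcut : ∀ m : Measure ℂ, m (Metric.closedBall 0 (2 * R))ᶜ = 0 →
      ∫ w, f w ∂m = ∫ w, f w * χ w ∂m := fun m hm => by
    refine integral_congr_ae ?_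
    filter_upwards [measure_eq_zero_iff_ae_notMem.1 hm] with w hw
    rw [Set.notMem_compl_iff, mem_closedBall_zero_iff] at hw
    have : χ w = 1 := by
      simp only [hχ]
      rw [min_eq_left (by linarith), max_eq_right zero_le_one]
    rw [this, mul_one]
  have hcutn : ∀ n, ∫ w, f w ∂(solutionMeasure z n : Measure ℂ) =
      ∫ w, f w * χ w ∂(solutionMeasure z n : Measure ℂ) := fun n =>
    hcut _ ((FiniteMeasure.null_iff_toMeasure_null _ _).1 (solutionMeasure_compl_closedBall hz n))
  have hcutν : ∫ w, f w ∂(ν.toFiniteMeasure : Measure ℂ) = ∫ w, f w * χ w ∂(ν : Measure ℂ) :=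
    hcut _ hνR
  simp_rw [hcutn, hcutν]
  rw [Metric.tendsto_nhds]
  intro ε hε
  obtain ⟨g, hg, hgc, -, -, hgφ⟩ := exists_log_potential_approx hφ hφc
    (show 0 < ε / 5 by positivity) one_pos
  have hlimν := hν _ g hφ hφc hg hgc _ (by positivity) hgφ
  filter_upwards [eventually_abs_integral_solutionMeasure_sub_le hz hV hlim hg hgc
    (by positivity) hgφ] with n hn
  rw [Real.dist_eq]
  rw [abs_le] at hlimν hn
  rw [abs_lt]
  constructor <;> linarith [hlimν.1, hlimν.2, hn.1, hn.2]

end Limit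

/-! ### Identification of the limit -/

theorem measure_le_of_forall_integral_le {m₁ m₂ : Measure ℂ} [IsFiniteMeasure m₁]
    [IsFiniteMeasure m₂] {O : Set ℂ} (hO : IsOpen O)
    (h : ∀ φ : ℂ → ℝ, Continuous φ → HasCompactSupport φ → tsupport φ ⊆ O →
      ∫ x, φ x ∂m₁ ≤ ∫ x, φ x ∂m₂) : m₁ O ≤ m₂ O := by
  rw [hO.measure_eq_iSup_isCompact m₁]
  refine iSup_le fun K => iSup_le fun hKO => iSup_le fun hK => ?_
  obtain ⟨φ, hφ1, hφc, hφO, hφ01⟩ :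
      ∃ φ : C(ℂ, ℝ), Set.EqOn φ 1 K ∧ HasCompactSupport φ ∧ tsupport φ ⊆ O ∧
        ∀ x, φ x ∈ Set.Icc (0 : ℝ) 1 := by
    obtain ⟨k, -, hkc, hKk, hkO⟩ := exists_compact_closed_between hK hO hKO
    obtain ⟨φ, h1, h0, hc, h01⟩ := exists_continuous_one_zero_of_isCompact hK
      isOpen_interior.isClosed_compl (Set.disjoint_compl_right_iff_subset.2 hKk)
    refine ⟨φ, h1, hc, (closure_minimal (fun x hx => ?_) hkc).trans hkO, h01⟩
    by_contra hxk
    exact hx (h0 fun hxi => hxk (interior_subset hxi))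
  have h1 : m₁.real K ≤ ∫ x, φ x ∂m₁ := by
    rw [← integral_indicator_one hK.measurableSet]
    refine integral_mono ((integrable_const 1).indicator hK.measurableSet)
      (φ.continuous.integrable_of_hasCompactSupport hφc) fun x => ?_
    by_cases hx : x ∈ K
    · rw [Set.indicator_of_mem hx, hφ1 hx]
    · rw [Set.indicator_of_notMem hx]
      exact (hφ01 x).1
  have h2 : ∫ x, φ x ∂m₂ ≤ m₂.real O := by
    rw [← integral_indicator_one hO.measurableSet]
    refine integral_mono (φ.continuous.integrable_of_hasCompactSupport hφc)
      ((integrable_const 1).indicator hO.measurableSet) fun x => ?_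
    by_cases hx : x ∈ O
    · rw [Set.indicator_of_mem hx]
      exact (hφ01 x).2
    · rw [image_eq_zero_of_notMem_tsupport fun hx' => hx (hφO hx')]
      exact Set.indicator_nonneg (fun _ _ => zero_le_one) _
  have h3 := h1.trans ((h φ φ.continuous hφc hφO).trans h2)
  exact (ENNReal.toReal_le_toReal (measure_ne_top _ _) (measure_ne_top _ _)).1 h3

theorem restrict_eq_of_forall_integral_eq {m₁ m₂ : Measure ℂ} [IsFiniteMeasure m₁]
    [IsFiniteMeasure m₂] {O : Set ℂ} (hO : IsOpen O)
    (h : ∀ φ : ℂ → ℝ, Continuous φ → HasCompactSupport φ → tsupport φ ⊆ O →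
      ∫ x, φ x ∂m₁ = ∫ x, φ x ∂m₂) : m₁.restrict O = m₂.restrict O := by
  have key : ∀ s, IsOpen s → m₁.restrict O s = m₂.restrict O s := fun s hs => by
    rw [Measure.restrict_apply hs.measurableSet, Measure.restrict_apply hs.measurableSet]
    have hs' : ∀ {φ : ℂ → ℝ}, tsupport φ ⊆ s ∩ O → tsupport φ ⊆ O :=
      fun hφ => hφ.trans Set.inter_subset_right
    exact le_antisymm
      (measure_le_of_forall_integral_le (hs.inter hO) fun φ h1 h2 h3 => (h φ h1 h2 (hs' h3)).le)
      (measure_le_of_forall_integral_le (hs.inter hO) fun φ h1 h2 h3 => (h φ h1 h2 (hs' h3)).ge)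
  exact ext_of_generate_finite _ (BorelSpace.measurable_eq (α := ℂ)) isPiSystem_isOpen
    (fun s hs => key s hs) (key _ isOpen_univ)

theorem theorem2 (μ : Measure ℂ) [IsProbabilityMeasure μ]
    (f : ℂ → ℝ≥0) (hf_cont : Continuous f) (hf_supp : HasCompactSupport f)
    (hμ : μ = (volume : Measure ℂ).withDensity (fun z => (f z : ℝ≥0∞))) :
    ∃ ν : ProbabilityMeasure ℂ,
      (ν : Measure ℂ).restrict (potentialAbove μ) = μ.restrict (potentialAbove μ) ∧
      (ν : Measure ℂ) (potentialLevel μ) = 1 - μ (potentialAbove μ) ∧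
      ∀ (Ω : Type*) [MeasurableSpace Ω] (P : Measure Ω) [IsProbabilityMeasure P]
        (Z : ℕ → Ω → ℂ), (∀ k, HasLaw (Z k) μ P) → iIndepFun Z P →
        ∀ᵐ ω ∂P, Tendsto (fun n : ℕ => solutionMeasure (fun k => Z k ω) n) atTop
          (𝓝 ν.toFiniteMeasure) := by
  obtain ⟨R, hR⟩ := exists_ae_norm_le hf_supp hf_cont hμ
  obtain ⟨M, hM⟩ := exists_measure_le_mul_volume hf_cont hf_supp hμ
  have hint := integrable_log_norm_sub hf_cont hf_supp hμ
  have hU := continuous_logPotential hf_cont hf_supp hμ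
  set V : ℂ → ℝ := fun w => max (logPotential μ w) (logPotential μ 0) with hVdef
  have hV : Continuous V := hU.max continuous_const
  have hgood : ∀ᵐ ω ∂(Measure.infinitePi fun _ : ℕ => μ), (∀ k, ‖ω k‖ ≤ R) ∧
      ∀ᵐ w, Tendsto (fun n => solutionPotential ω n w) atTop (𝓝 (V w)) :=
    (ae_forall_infinitePi hR).and (ae_ae_tendsto_solutionPotential hM hR hint hU)
  -- The limit is a cluster point for one typical realisation of the roots.
  obtain ⟨ω₀, hω₀, hlim₀⟩ := hgood.exists
  obtain ⟨ν, F, hF, hνR, hνF⟩ := exists_cluster_solutionMeasure hω₀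
  have hν : ∀ φ g : ℂ → ℝ, Continuous φ → HasCompactSupport φ → Continuous g →
      HasCompactSupport g → ∀ ε > 0, (∀ w, |(∫ x, Real.log ‖x - w‖ * g x) - φ w| ≤ ε) →
      |(∫ w, φ w ∂(ν : Measure ℂ)) - ∫ x, V x * g x| ≤ 2 * ε :=
    fun φ g hφ hφc hg hgc ε hε hgφ =>
      abs_integral_cluster_sub_le hω₀ hV hlim₀ hF hνF hφ hφc hg hgc hε hgφ
  have hAopen : IsOpen (potentialAbove μ) := isOpen_lt continuous_const hU
  set D : Set ℂ := {w | logPotential μ w < logPotential μ 0} with hD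
  have hDopen : IsOpen D := isOpen_lt hU continuous_const
  -- Near the support of a test function on the first open set, `V` is the potential of `μ`.
  have hA : ∀ φ : ℂ → ℝ, Continuous φ → HasCompactSupport φ → tsupport φ ⊆ potentialAbove μ →
      ∫ x, φ x ∂(ν : Measure ℂ) = ∫ x, φ x ∂μ := by
    intro φ hφ hφc hφA
    refine eq_of_forall_dist_le fun ε hε => ?_
    obtain ⟨δ, hδ, hδA⟩ := hφc.isCompact.exists_cthickening_subset_open hAopen hφA
    obtain ⟨g, hg, hgc, hgs, -, hgφ⟩ := exists_log_potential_approx hφ hφc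
      (show 0 < ε / 3 by positivity) hδ
    have h1 := hν φ g hφ hφc hg hgc _ (by positivity) hgφ
    have h2 : ∫ x, V x * g x = ∫ x, logPotential μ x * g x := by
      congr 1
      ext x
      by_cases hx : x ∈ Function.support g
      · have hxA : logPotential μ 0 < logPotential μ x := hδA (hgs hx)
        simp only [hVdef, max_eq_left hxA.le]
      · simp [Function.notMem_support.1 hx]
    obtain ⟨hgi, hgeq⟩ := integral_logPotential_mul hR hg hgc
    have h3 : |(∫ x, (∫ y, Real.log ‖y - x‖ * g y) ∂μ) - ∫ x, φ x ∂μ| ≤ ε / 3 := by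
      rw [← integral_sub hgi (hφ.integrable_of_hasCompactSupport hφc)]
      have hb := norm_integral_le_of_norm_le_const (μ := μ)
        (f := fun w => (∫ x, Real.log ‖x - w‖ * g x) - φ w) (Eventually.of_forall hgφ)
      simpa using hb
    rw [h2, hgeq, abs_le] at h1
    rw [abs_le] at h3
    rw [Real.dist_eq, abs_le]
    constructor <;> linarith [h1.1, h1.2, h3.1, h3.2]
  -- Below the level, `V` is constant and the approximating densities have total mass zero.
  have hDint : ∀ φ : ℂ → ℝ, Continuous φ → HasCompactSupport φ → tsupport φ ⊆ D →
      ∫ x, φ x ∂(ν : Measure ℂ) = ∫ x, φ x ∂(0 : Measure ℂ) := by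
    intro φ hφ hφc hφD
    rw [integral_zero_measure]
    refine eq_of_forall_dist_le fun ε hε => ?_
    obtain ⟨δ, hδ, hδD⟩ := hφc.isCompact.exists_cthickening_subset_open hDopen hφD
    obtain ⟨g, hg, hgc, hgs, hg0, hgφ⟩ := exists_log_potential_approx hφ hφc
      (show 0 < ε / 2 by positivity) hδ
    have h1 := hν φ g hφ hφc hg hgc _ (by positivity) hgφ
    have h2 : ∫ x, V x * g x = ∫ x, logPotential μ 0 * g x := by
      congr 1
      ext x
      by_cases hx : x ∈ Function.support g
      · have hxD : logPotential μ x < logPotential μ 0 := hδD (hgs hx)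
        simp only [hVdef, max_eq_right hxD.le]
      · simp [Function.notMem_support.1 hx]
    rw [h2, integral_const_mul, hg0, mul_zero] at h1
    rw [Real.dist_eq]
    linarith
  have hrestrict := restrict_eq_of_forall_integral_eq hAopen hA
  refine ⟨ν, hrestrict, ?_, ?_⟩
  · have hνA : (ν : Measure ℂ) (potentialAbove μ) = μ (potentialAbove μ) := by
      simpa using congrArg (fun m => m (potentialAbove μ)) hrestrict
    have hνD : (ν : Measure ℂ) D = 0 :=
      le_antisymm (measure_le_of_forall_integral_le (m₂ := 0) hDopen
        fun φ h1 h2 h3 => (hDint φ h1 h2 h3).le) zero_le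
    have hB : potentialLevel μ = (potentialAbove μ ∪ D)ᶜ := by
      ext w
      simp only [potentialLevel, potentialAbove, hD, Set.mem_ofPred_eq, Set.mem_compl_iff,
        Set.mem_union, not_or, not_lt, gt_iff_lt, le_antisymm_iff]
    have hunion : (ν : Measure ℂ) (potentialAbove μ ∪ D) = (ν : Measure ℂ) (potentialAbove μ) :=
      le_antisymm ((measure_union_le _ _).trans (by rw [hνD, add_zero]))
        (measure_mono Set.subset_union_left)
    rw [hB, prob_compl_eq_one_sub (hAopen.union hDopen).measurableSet, hunion, hνA]
  · intro Ω _ P _ Z hZ hind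
    have hZm : AEMeasurable (fun ω k => Z k ω) P :=
      aemeasurable_pi_iff.2 fun k => (hZ k).aemeasurable
    have hlaw := iIndepFun.hasLaw_infinitePi hZ hind hZm
    rw [← hlaw.map_eq] at hgood
    filter_upwards [ae_of_ae_map hZm hgood] with ω hω
    exact tendsto_solutionMeasure hω.1 hV hω.2 hνR hν
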